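/- Let $n\ge 1$, let $h=(h_1,\dots,h_n)^{\mathsf T}$ have positive entries with $\sum_{i=1}^n h_i=1$, let $\alpha=(\alpha_1,\dots,\alpha_n)^{\mathsf T}$ satisfy $1\ge\alpha_1\ge\alpha_2\ge\cdots\ge\alpha_n\ge 0$, and let $\sigma>0$. Put $\mathsf H_{[k]}=\sum_{i=1}^k h_i$ and $\bar\alpha_k=\frac{\sum_{i=k+1}^n h_i\alpha_i}{1-\mathsf H_{[k]}}$ for $1\le k\le n-1$. Let $\mathsf C_{\mathrm E}(h,\alpha,\sigma)$ be the (single-letter) capacity of the equal-cost multiple-input single-output optical intensity channel (EC-OIC) $Y=h^{\mathsf T}X+Z$, where $Z\sim\mathcal N(0,\sigma^2)$ is independent of $X$; that is, $$\mathsf C_{\mathrm E}(h,\alpha,\sigma)=\sup\, I(X;\,h^{\mathsf T}X+Z),$$ the supremum being over all laws of random vectors $X=(X_1,\dots,X_n)^{\mathsf T}$ with $0\le X_k\le 1$ almost surely and $\mathbb E[X_k]=\alpha_k$ for every $k\in\{1,\dots,n\}$. Then $$\mathsf C_{\mathrm E}(h,\alpha,\sigma)=\sup\, I(S;\,S+Z),$$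 where the supremum is over all laws of random variables $S$ independent of $Z$ and supported in $[0,1]$ such that $$\mathbb E[S]=h^{\mathsf T}\alpha\qquad\text{and}\qquad \mathbb E\big[(S-\mathsf H_{[k]})_+\big]\le(1-\mathsf H_{[k]})\,\bar\alpha_k\quad\text{for all }k\in\{1,\dots,n-1\},$$ with $(a)_+=\max\{a,0\}$. -/

import Mathlib

open MeasureTheory ProbabilityTheory
open scoped ENNReal NNReal

noncomputable section

namespace OIC

/-- The mutual information `I(U; V)` (in nats) of two random variables on a common probability
space: the Kullback-Leibler divergence of the joint law from the product of the marginal laws. -/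
def mutualInfo {Ω 𝓤 𝓥 : Type*} [MeasurableSpace Ω] [MeasurableSpace 𝓤] [MeasurableSpace 𝓥]
    (U : Ω → 𝓤) (V : Ω → 𝓥) (P : Measure Ω) : ℝ≥0∞ :=
  InformationTheory.klDiv (P.map (fun ω => (U ω, V ω))) ((P.map U).prod (P.map V))

/-- The law of the additive noise `Z ∼ 𝒩(0, σ²)`. -/
def noise (σ : ℝ) : Measure ℝ :=
  gaussianReal 0 (Real.toNNReal (σ ^ 2))

/-- The inner product `hᵀ x`. -/
def weightedSum {n : ℕ} (h x : Fin n → ℝ) : ℝ :=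
  ∑ i, h i * x i

/-- The cumulative channel gain `H_[k] = h_1 + ⋯ + h_k`. The gain `h_i` is the value of `h` at the
zero-based index `i - 1`, so the first `k` gains are those at the indices `0, …, k - 1`. -/
def cumGain {n : ℕ} (h : Fin n → ℝ) (k : ℕ) : ℝ :=
  ∑ i with (i : Fin n).val < k, h i

/-- The weighted average intensity of the last `n - k` transmitters,
`ᾱ_k = (h_{k+1} α_{k+1} + ⋯ + h_n α_n) / (1 - H_[k])`. -/
def tailAvg {n : ℕ} (h α : Fin n → ℝ) (k : ℕ) : ℝ :=
  (∑ i with k ≤ (i : Fin n).val, h i * α i) / (1 - cumGain h k)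

/-- `μ` is the law of an input vector `X` that satisfies the equal-cost constraints
`0 ≤ X_k ≤ 1` and `E[X_k] = α_k` for all `k`. -/
structure IsFeasibleInput {n : ℕ} (α : Fin n → ℝ) (μ : Measure (Fin n → ℝ)) : Prop where
  isProbabilityMeasure : IsProbabilityMeasure μ
  mem_Icc : ∀ᵐ x ∂μ, ∀ k, x k ∈ Set.Icc (0 : ℝ) 1
  mean_eq : ∀ k, ∫ x, x k ∂μ = α k

/-- The capacity of the EC-OIC: the supremum of `I(X; hᵀ X + Z)` over the laws of `X` that satisfy
the equal-cost constraints, where `Z ∼ 𝒩(0, σ²)` is independent of `X`. The pair `(X, Z)` is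
realized as the coordinates of the product space. -/
def capacityEC {n : ℕ} (h α : Fin n → ℝ) (σ : ℝ) : ℝ≥0∞ :=
  ⨆ (μ : Measure (Fin n → ℝ)) (_ : IsFeasibleInput α μ),
    mutualInfo (fun ω : (Fin n → ℝ) × ℝ => ω.1) (fun ω => weightedSum h ω.1 + ω.2)
      (μ.prod (noise σ))

/-- `ν` is the law of a random variable `S` with support in `[0, 1]` that satisfies the mean
constraint `E[S] = hᵀ α` and the stop-loss mean constraints
`E[(S - H_[k])_+] ≤ (1 - H_[k]) ᾱ_k` for `k = 1, …, n - 1`. -/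
structure IsStopLossFeasible {n : ℕ} (h α : Fin n → ℝ) (ν : Measure ℝ) : Prop where
  isProbabilityMeasure : IsProbabilityMeasure ν
  mem_Icc : ∀ᵐ s ∂ν, s ∈ Set.Icc (0 : ℝ) 1
  mean_eq : ∫ s, s ∂ν = weightedSum h α
  stopLoss_le : ∀ k : ℕ, 1 ≤ k → k ≤ n - 1 →
    ∫ s, max (s - cumGain h k) 0 ∂ν ≤ (1 - cumGain h k) * tailAvg h α k

end OIC

end

namespace OIC

/-! The output sees `X` only through `S = hᵀX`, so `I(X; S + Z) = I(S; S + Z)`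
(`mutualInfo_add_noise`), and it remains to show that the laws of `hᵀX` are exactly the stop-loss
feasible ones. Necessity is pointwise: `(S - H_[k])_+` is at most the contribution of the last `n -
k` coordinates. For sufficiency, split `s` greedily among the coordinates in the order of a
permutation; each such split lies in the cube and has weighted sum `s`, and so do convex
combinations. By `mem_convexHull`, `α` is a convex combination of the greedy mean vectors: given a
separating functional `w`, the greedy order by decreasing `w i / h i` contradicts the separation, by
Abel summation and the bounds `∑_A h i α i ≤ E[min(S, ∑_A h i)]`. -/

instance (σ : ℝ) : IsProbabilityMeasure (noise σ) := by
  unfold noise; infer_instance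

/-! ### Reduction of the mutual information to the scalar channel -/

/-- If `μ` has a density with respect to `ν` that factors through a measurable map `T`, then `T` is
a sufficient statistic and preserves the Kullback-Leibler divergence. -/
theorem klDiv_withDensity_comp {A B : Type*} [MeasurableSpace A] [MeasurableSpace B]
    (ν : Measure A) [IsFiniteMeasure ν] {T : A → B} (hT : Measurable T)
    {f : B → ℝ≥0∞} (hf : Measurable f)
    [IsFiniteMeasure (ν.withDensity (f ∘ T))] [IsFiniteMeasure ((ν.map T).withDensity f)] :
    InformationTheory.klDiv (ν.withDensity (f ∘ T)) ν =
      InformationTheory.klDiv ((ν.map T).withDensity f) (ν.map T) := by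
  rw [InformationTheory.klDiv_eq_lintegral_klFun_of_ac (withDensity_absolutelyContinuous _ _),
    InformationTheory.klDiv_eq_lintegral_klFun_of_ac (withDensity_absolutelyContinuous _ _)]
  have h1 := Measure.rnDeriv_withDensity ν (hf.comp hT)
  have h2 := Measure.rnDeriv_withDensity (ν.map T) hf
  rw [lintegral_congr_ae (h1.mono fun x hx => by rw [hx]),
    lintegral_congr_ae (h2.mono fun x hx => by rw [hx]), lintegral_map (by fun_prop) hT]
  rfl

/-- The density at `y` of the output of the additive noise channel with input law `ν`. -/
noncomputable def outputDensity (p : ℝ → ℝ≥0∞) (ν : Measure ℝ) (y : ℝ) : ℝ≥0∞ :=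
  ∫⁻ s, p (y - s) ∂ν

theorem measurable_outputDensity {p : ℝ → ℝ≥0∞} (hp : Measurable p) (ν : Measure ℝ) [SFinite ν] :
    Measurable (outputDensity p ν) := by
  unfold outputDensity
  exact Measurable.lintegral_prod_right' (f := fun q : ℝ × ℝ => p (q.1 - q.2)) (by fun_prop)

theorem lintegral_add_noise {E : Type*} [MeasurableSpace E] (μ : Measure E) [SFinite μ]
    {s : E → ℝ} (hs : Measurable s) {p : ℝ → ℝ≥0∞} (hp : Measurable p)
    {g : E × ℝ → ℝ≥0∞} (hg : Measurable g) :
    ∫⁻ ω, g (ω.1, s ω.1 + ω.2) ∂(μ.prod (volume.withDensity p)) =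
      ∫⁻ x, (∫⁻ y, p (y - s x) * g (x, y)) ∂μ := by
  rw [lintegral_prod _ (by fun_prop)]
  refine lintegral_congr fun x => ?_
  rw [lintegral_withDensity_eq_lintegral_mul _ hp (by fun_prop),
    ← lintegral_add_left_eq_self (μ := volume) (fun y => p (y - s x) * g (x, y)) (s x)]
  simp

theorem map_output_eq {E : Type*} [MeasurableSpace E] (μ : Measure E) [SFinite μ]
    {s : E → ℝ} (hs : Measurable s) {p : ℝ → ℝ≥0∞} (hp : Measurable p) :
    (μ.prod (volume.withDensity p)).map (fun ω => s ω.1 + ω.2) =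
      volume.withDensity (outputDensity p (μ.map s)) := by
  refine Measure.ext_of_lintegral _ fun g hg => ?_
  rw [lintegral_map hg (by fun_prop),
    lintegral_add_noise μ hs hp (g := fun ω => g ω.2) (by fun_prop),
    lintegral_lintegral_swap (by fun_prop),
    lintegral_withDensity_eq_lintegral_mul _ (measurable_outputDensity hp _) hg]
  refine lintegral_congr fun y => ?_
  change ∫⁻ x, p (y - s x) * g y ∂μ = _
  rw [lintegral_mul_const _ (by fun_prop), Pi.mul_apply, outputDensity,
    lintegral_map (by fun_prop) hs]

/-- Dividing by the reference density `q` gives a density that factors through `Prod.map s id`, the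
form that `klDiv_withDensity_comp` needs. -/
theorem map_joint_eq {E : Type*} [MeasurableSpace E] (μ : Measure E) [SFinite μ]
    {s : E → ℝ} (hs : Measurable s) {p q : ℝ → ℝ≥0∞} (hp : Measurable p) (hq : Measurable q)
    (hq0 : ∀ y, q y ≠ 0) (hqt : ∀ y, q y ≠ ∞) :
    (μ.prod (volume.withDensity p)).map (fun ω => (ω.1, s ω.1 + ω.2)) =
      (μ.prod (volume.withDensity q)).withDensity
        ((fun ω : ℝ × ℝ => p (ω.2 - ω.1) / q ω.2) ∘ Prod.map s id) := by
  refine Measure.ext_of_lintegral _ fun g hg => ?_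
  have hf : Measurable ((fun ω : ℝ × ℝ => p (ω.2 - ω.1) / q ω.2) ∘ Prod.map s id) := by fun_prop
  rw [lintegral_map hg (by fun_prop), lintegral_add_noise μ hs hp hg,
    lintegral_withDensity_eq_lintegral_mul _ hf hg, lintegral_prod _ (hf.mul hg).aemeasurable]
  refine lintegral_congr fun x => ?_
  rw [lintegral_withDensity_eq_lintegral_mul _ hq (by fun_prop)]
  refine lintegral_congr fun y => ?_
  simp only [Pi.mul_apply, Function.comp_apply, Prod.map_apply, id_eq]
  rw [← mul_assoc, ENNReal.mul_div_cancel (hq0 y) (hqt y)]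

theorem gaussianPDF_zero_le (v : ℝ≥0) (x : ℝ) :
    gaussianPDF 0 v x ≤ ENNReal.ofReal (√(2 * Real.pi * v))⁻¹ := by
  unfold gaussianPDF gaussianPDFReal
  refine ENNReal.ofReal_le_ofReal (mul_le_of_le_one_right (by positivity) ?_)
  rw [Real.exp_le_one_iff]
  exact div_nonpos_of_nonpos_of_nonneg (neg_nonpos.2 (sq_nonneg _)) (by positivity)

/-- The additive noise channel sees its input `x` only through `s x`. -/
theorem mutualInfo_add_noise {E : Type*} [MeasurableSpace E] (μ : Measure E)
    [IsProbabilityMeasure μ] {s : E → ℝ} (hs : Measurable s) {σ : ℝ} (hσ : 0 < σ) :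
    mutualInfo (fun ω : E × ℝ => ω.1) (fun ω => s ω.1 + ω.2) (μ.prod (noise σ)) =
      mutualInfo (fun ω : ℝ × ℝ => ω.1) (fun ω => ω.1 + ω.2) ((μ.map s).prod (noise σ)) := by
  have hv : Real.toNNReal (σ ^ 2) ≠ 0 := by
    rw [Ne, Real.toNNReal_eq_zero, not_le]; positivity
  have hprob := Measure.isProbabilityMeasure_map (μ := μ) hs.aemeasurable
  set p := gaussianPDF 0 (Real.toNNReal (σ ^ 2)) with hp_def
  -- The output density depends on `μ` only through `μ.map s`, so both channels share it.
  set q := outputDensity p (μ.map s) with hq_def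
  have hp : Measurable p := measurable_gaussianPDF _ _
  have hq : Measurable q := measurable_outputDensity hp _
  have hnoise : noise σ = volume.withDensity p := gaussianReal_of_var_ne_zero _ hv
  have hq0 : ∀ y, q y ≠ 0 := fun y => by
    rw [hq_def, outputDensity, Ne, lintegral_eq_zero_iff (by fun_prop)]
    intro h0
    obtain ⟨x, hx⟩ := h0.exists
    exact (gaussianPDF_pos _ hv _).ne' hx
  have hqt : ∀ y, q y ≠ ∞ := fun y => by
    refine ((lintegral_mono fun x => gaussianPDF_zero_le _ (y - x)).trans_lt ?_).ne
    rw [lintegral_const, measure_univ, mul_one]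
    exact ENNReal.ofReal_lt_top
  have hX := map_output_eq μ hs hp
  have hS := map_output_eq (μ.map s) measurable_id hp
  have hJX := map_joint_eq μ hs hp hq hq0 hqt
  have hJS := map_joint_eq (μ.map s) measurable_id hp hq hq0 hqt
  simp only [Measure.map_id, id_eq, Prod.map_id, Function.comp_id] at hS hJS
  rw [← hnoise] at hX hS hJX hJS
  have hρ : IsProbabilityMeasure (volume.withDensity q) := by
    rw [← hS]; exact Measure.isProbabilityMeasure_map (by fun_prop)
  have hprod : (μ.prod (volume.withDensity q)).map (Prod.map s id) =
      (μ.map s).prod (volume.withDensity q) := by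
    rw [← Measure.map_prod_map _ _ hs measurable_id, Measure.map_id]
  unfold mutualInfo
  rw [hJX, hJS, hX, hS, Measure.map_fst_prod, Measure.map_fst_prod, measure_univ, one_smul,
    one_smul, ← hprod]
  have : IsFiniteMeasure ((μ.prod (volume.withDensity q)).withDensity
      ((fun ω : ℝ × ℝ => p (ω.2 - ω.1) / q ω.2) ∘ Prod.map s id)) := by
    rw [← hJX]; infer_instance
  have : IsFiniteMeasure (((μ.prod (volume.withDensity q)).map (Prod.map s id)).withDensity
      (fun ω : ℝ × ℝ => p (ω.2 - ω.1) / q ω.2)) := by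
    rw [hprod, ← hJS]; infer_instance
  exact klDiv_withDensity_comp _ (by fun_prop) (by fun_prop)

/-! ### Prefix sums along a permutation and greedy filling -/

/-- The sum of `f` over the first `j` indices in the order given by `e`. -/
noncomputable def prefixSum {n : ℕ} (e : Equiv.Perm (Fin n)) (f : Fin n → ℝ) (j : ℕ) : ℝ :=
  ∑ i with (e.symm i).val < j, f i

section Prefix

variable {n : ℕ} (e : Equiv.Perm (Fin n)) (f : Fin n → ℝ)

theorem prefixSum_zero : prefixSum e f 0 = 0 := by simp [prefixSum]

theorem prefixSum_length : prefixSum e f n = ∑ i, f i := by simp [prefixSum]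

theorem prefixSum_succ (i : Fin n) :
    prefixSum e f ((e.symm i).val + 1) = prefixSum e f (e.symm i).val + f i := by
  have : (Finset.univ.filter fun j => (e.symm j).val < (e.symm i).val + 1) =
      insert i (Finset.univ.filter fun j => (e.symm j).val < (e.symm i).val) := by
    ext j
    simp only [Finset.mem_filter, Finset.mem_univ, true_and, Finset.mem_insert, Nat.lt_succ_iff,
      le_iff_lt_or_eq, Fin.val_inj, e.symm.injective.eq_iff]
    tauto
  rw [prefixSum, this, Finset.sum_insert (by simp), add_comm, prefixSum]

theorem sum_rank_succ_sub (G : ℕ → ℝ) :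
    ∑ i, (G ((e.symm i).val + 1) - G (e.symm i).val) = G n - G 0 := by
  rw [e.symm.sum_comp (fun j : Fin n => G (j.val + 1) - G j.val),
    Fin.sum_univ_eq_sum_range (fun j => G (j + 1) - G j), Finset.sum_range_sub]

/-- Abel summation: each step leaves a surplus `(d m - d (m + 1)) * F (m + 1) ≥ 0`. -/
theorem sum_mul_succ_sub_nonneg {d F : ℕ → ℝ} (hd : Antitone d) (hF : ∀ j, 0 ≤ F j)
    (h0 : F 0 = 0) (m : ℕ) :
    d m * F m ≤ ∑ j ∈ Finset.range m, d j * (F (j + 1) - F j) := by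
  induction m with
  | zero => simp [h0]
  | succ m ih =>
    rw [Finset.sum_range_succ]
    nlinarith [mul_le_mul_of_nonneg_right (hd m.le_succ) (hF (m + 1))]

theorem sum_antitone_mul_nonneg {c : Fin n → ℝ} (hc : Antitone (c ∘ e)) {F : ℕ → ℝ}
    (hF : ∀ j, 0 ≤ F j) (h0 : F 0 = 0) (hn : F n = 0) :
    0 ≤ ∑ i, c i * (F ((e.symm i).val + 1) - F (e.symm i).val) := by
  obtain _ | m := n
  · simp
  -- Constant continuation past the last index keeps `d` antitone on all of `ℕ`.
  let d : ℕ → ℝ := fun j => c (e ⟨min j m, by omega⟩)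
  have hd : Antitone d := fun a b hab => hc (Fin.mk_le_mk.2 (min_le_min_right m hab))
  have key := sum_mul_succ_sub_nonneg hd hF h0 (m + 1)
  rw [hn, mul_zero] at key
  rw [← Equiv.sum_comp e]
  simp only [Equiv.symm_apply_apply]
  rw [← Fin.sum_univ_eq_sum_range] at key
  refine key.trans_eq (Finset.sum_congr rfl fun j _ => ?_)
  have hj : d j.val = c (e j) :=
    congrArg (fun x => c (e x)) (Fin.ext (min_eq_left (Nat.lt_succ_iff.1 j.2)))
  rw [hj]

end Prefix

/-- The amount each coordinate receives when `s` is filled greedily in the order given by `e`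
into containers of size `h i`, as a fraction of the size. -/
noncomputable def greedyFill {n : ℕ} (h : Fin n → ℝ) (e : Equiv.Perm (Fin n)) (s : ℝ) (i : Fin n) :
    ℝ :=
  (min s (prefixSum e h ((e.symm i).val + 1)) - min s (prefixSum e h (e.symm i).val)) / h i

theorem continuous_greedyFill {n : ℕ} (h : Fin n → ℝ) (e : Equiv.Perm (Fin n)) :
    Continuous (greedyFill h e) := by
  unfold greedyFill
  fun_prop

section Greedy

variable {n : ℕ} {h : Fin n → ℝ}

theorem mul_greedyFill (hh_pos : ∀ i, 0 < h i) (e : Equiv.Perm (Fin n))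
    (s : ℝ) (i : Fin n) : h i * greedyFill h e s i =
    min s (prefixSum e h ((e.symm i).val + 1)) - min s (prefixSum e h (e.symm i).val) :=
  mul_div_cancel₀ _ (hh_pos i).ne'

theorem greedyFill_mem_Icc (hh_pos : ∀ i, 0 < h i) (e : Equiv.Perm (Fin n))
    (s : ℝ) (i : Fin n) : greedyFill h e s i ∈ Set.Icc (0 : ℝ) 1 := by
  unfold greedyFill
  rw [prefixSum_succ]
  have hi := hh_pos i
  constructor
  · refine div_nonneg (sub_nonneg.2 (min_le_min_left _ ?_)) hi.le
    linarith
  · rw [div_le_one hi]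
    grind

theorem weightedSum_greedyFill (hh_pos : ∀ i, 0 < h i) (e : Equiv.Perm (Fin n))
    (hh_sum : ∑ i, h i = 1) {s : ℝ} (hs : s ∈ Set.Icc (0 : ℝ) 1) :
    weightedSum h (greedyFill h e s) = s := by
  unfold weightedSum
  simp_rw [mul_greedyFill hh_pos]
  rw [sum_rank_succ_sub e (fun j => min s (prefixSum e h j)), prefixSum_length, prefixSum_zero,
    hh_sum, min_eq_left hs.2, min_eq_right hs.1, sub_zero]

end Greedy

/-! ### From prefix constraints to arbitrary sets of coordinates -/

theorem cumGain_add_tail {n : ℕ} (f : Fin n → ℝ) (k : ℕ) :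
    cumGain f k + ∑ i with k ≤ (i : Fin n).val, f i = ∑ i, f i := by
  unfold cumGain
  rw [← Finset.sum_filter_add_sum_filter_not Finset.univ (fun i : Fin n => i.val < k) f]
  simp only [not_lt]

theorem cumGain_succ {n : ℕ} (f : Fin n → ℝ) (i : Fin n) :
    cumGain f (i.val + 1) = cumGain f i.val + f i :=
  prefixSum_succ (Equiv.refl _) f i

theorem tail_pos {n : ℕ} {h : Fin n → ℝ} (hh_pos : ∀ i, 0 < h i) {k : ℕ} (hk : k < n) :
    0 < ∑ i with k ≤ (i : Fin n).val, h i :=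
  Finset.sum_pos (fun i _ => hh_pos i) ⟨⟨k, hk⟩, by simp⟩

theorem one_sub_cumGain_mul_tailAvg {n : ℕ} {h : Fin n → ℝ} (α : Fin n → ℝ)
    (hh_pos : ∀ i, 0 < h i) (hh_sum : ∑ i, h i = 1) {k : ℕ} (hk : k < n) :
    (1 - cumGain h k) * tailAvg h α k = ∑ i with k ≤ (i : Fin n).val, h i * α i := by
  refine mul_div_cancel₀ _ ?_
  linarith [cumGain_add_tail h k, tail_pos hh_pos hk]

section StopLoss

variable {n : ℕ} {h α : Fin n → ℝ} {ν : Measure ℝ}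

theorem IsStopLossFeasible.integrable (hν : IsStopLossFeasible h α ν) :
    Integrable (fun s : ℝ => s) ν :=
  have := hν.isProbabilityMeasure
  Integrable.of_mem_Icc 0 1 aemeasurable_id hν.mem_Icc

theorem IsStopLossFeasible.integrable_min (hν : IsStopLossFeasible h α ν) (t : ℝ) :
    Integrable (fun s : ℝ => min s t) ν :=
  have := hν.isProbabilityMeasure
  hν.integrable.inf (integrable_const t)

theorem IsStopLossFeasible.integral_min_zero (hν : IsStopLossFeasible h α ν) :
    ∫ s, min s 0 ∂ν = 0 := by
  rw [integral_congr_ae (hν.mem_Icc.mono fun s hs => min_eq_right hs.1)]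
  simp

theorem IsStopLossFeasible.integral_min_one (hν : IsStopLossFeasible h α ν) :
    ∫ s, min s 1 ∂ν = ∑ i, h i * α i :=
  (integral_congr_ae (hν.mem_Icc.mono fun _ hs => min_eq_left hs.2)).trans hν.mean_eq

theorem IsStopLossFeasible.concaveOn (hν : IsStopLossFeasible h α ν) :
    ConcaveOn ℝ Set.univ (fun t => ∫ s, min s t ∂ν) := by
  refine ⟨convex_univ, fun x _ y _ a b ha hb hab => ?_⟩
  simp only [smul_eq_mul]
  rw [← integral_const_mul, ← integral_const_mul, ← integral_add
    ((hν.integrable_min x).const_mul a) ((hν.integrable_min y).const_mul b)]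
  refine integral_mono (((hν.integrable_min x).const_mul a).add
    ((hν.integrable_min y).const_mul b)) (hν.integrable_min _) fun s => le_min ?_ ?_
  · have hs : a * s + b * s = s := by rw [← add_mul, hab, one_mul]
    exact (add_le_add (mul_le_mul_of_nonneg_left (min_le_left s x) ha)
      (mul_le_mul_of_nonneg_left (min_le_left s y) hb)).trans_eq hs
  · exact add_le_add (mul_le_mul_of_nonneg_left (min_le_right s x) ha)
      (mul_le_mul_of_nonneg_left (min_le_right s y) hb)

/-- Since `min s t = s - (s - t)_+`, this is the stop-loss bound subtracted from the mean. The cases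
`k = 0` and `k = n`, absent from the constraints, follow from the support and the mean. -/
theorem IsStopLossFeasible.cumGain_le_integral_min (hν : IsStopLossFeasible h α ν)
    (hh_pos : ∀ i, 0 < h i) (hh_sum : ∑ i, h i = 1) {k : ℕ} (hk : k ≤ n) :
    cumGain (fun i => h i * α i) k ≤ ∫ s, min s (cumGain h k) ∂ν := by
  have := hν.isProbabilityMeasure
  obtain rfl | hk0 := k.eq_zero_or_pos
  · simp [cumGain, hν.integral_min_zero]
  obtain rfl | hkn := hk.eq_or_lt
  · have hall (f : Fin k → ℝ) : cumGain f k = ∑ i, f i := prefixSum_length (Equiv.refl _) f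
    rw [hall, hall, hh_sum, hν.integral_min_one]
  have hsl := hν.stopLoss_le k hk0 (by omega)
  rw [one_sub_cumGain_mul_tailAvg α hh_pos hh_sum hkn] at hsl
  have hmin (s : ℝ) : min s (cumGain h k) = s - max (s - cumGain h k) 0 := by grind
  have hint : Integrable (fun s => max (s - cumGain h k) 0) ν :=
    (hν.integrable.sub (integrable_const _)).pos_part
  simp_rw [hmin]
  rw [integral_sub hν.integrable hint, hν.mean_eq]
  have := cumGain_add_tail (fun i => h i * α i) k
  unfold weightedSum
  linarith

theorem exists_cumGain_le_le (hh_sum : ∑ i, h i = 1) {t : ℝ} (ht : t ∈ Set.Icc (0 : ℝ) 1) :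
    ∃ k : Fin n, cumGain h k.val ≤ t ∧ t ≤ cumGain h (k.val + 1) := by
  classical
  have hall : cumGain h n = 1 := (prefixSum_length (Equiv.refl _) h).trans hh_sum
  have hzero : cumGain h 0 = 0 := prefixSum_zero (Equiv.refl _) h
  have hn : n ≠ 0 := by rintro rfl; simp at hh_sum
  have hex : ∃ m, t ≤ cumGain h (m + 1) := ⟨n - 1, by
    rw [Nat.sub_add_cancel (Nat.one_le_iff_ne_zero.2 hn), hall]; exact ht.2⟩
  have hlt : Nat.find hex < n := (Nat.find_min' hex (m := n - 1) (by
    rw [Nat.sub_add_cancel (Nat.one_le_iff_ne_zero.2 hn), hall]; exact ht.2)).trans_lt (by omega)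
  refine ⟨⟨Nat.find hex, hlt⟩, ?_, Nat.find_spec hex⟩
  change cumGain h (Nat.find hex) ≤ t
  rcases hm : Nat.find hex with _ | m
  · simpa [hzero] using ht.1
  · exact (not_le.1 (Nat.find_min hex (m := m) (by omega))).le

/-- The terms `h i * (α i - α k)` are nonnegative for `i < k` and nonpositive afterwards, so the
prefix is the best choice of `A`. -/
theorem sum_mul_sub_le_cumGain (hh_pos : ∀ i, 0 < h i) (hα_anti : Antitone α)
    (A : Finset (Fin n)) (k : Fin n) :
    ∑ i ∈ A, h i * α i - α k * ∑ i ∈ A, h i ≤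
      cumGain (fun i => h i * α i) k.val - α k * cumGain h k.val := by
  unfold cumGain
  rw [Finset.mul_sum, Finset.mul_sum, ← Finset.sum_sub_distrib, ← Finset.sum_sub_distrib,
    Finset.sum_filter]
  refine (Finset.sum_le_sum (g := fun i => if i.val < k.val then h i * α i - α k * h i else 0)
    fun i _ => ?_).trans (Finset.sum_le_univ_sum_of_nonneg fun i => ?_)
  · split_ifs with hi
    · exact le_rfl
    · nlinarith [hh_pos i, hα_anti (Fin.le_def.2 (not_lt.1 hi))]
  · split_ifs with hi
    · nlinarith [hh_pos i, hα_anti (Fin.le_def.2 hi.le)]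
    · exact le_rfl

/-- The stop-loss constraints at the prefixes imply the corresponding constraint for every set of
coordinates. -/
theorem IsStopLossFeasible.sum_le_integral_min (hν : IsStopLossFeasible h α ν)
    (hh_pos : ∀ i, 0 < h i) (hh_sum : ∑ i, h i = 1) (hα_anti : Antitone α)
    (A : Finset (Fin n)) :
    ∑ i ∈ A, h i * α i ≤ ∫ s, min s (∑ i ∈ A, h i) ∂ν := by
  set t := ∑ i ∈ A, h i with ht
  obtain ⟨k, hk1, hk2⟩ := exists_cumGain_le_le (h := h) hh_sum (t := t)
    ⟨Finset.sum_nonneg fun i _ => (hh_pos i).le,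
      hh_sum ▸ Finset.sum_le_univ_sum_of_nonneg fun i => (hh_pos i).le⟩
  have hA := sum_mul_sub_le_cumGain hh_pos hα_anti A k
  have h1 := hν.cumGain_le_integral_min hh_pos hh_sum k.2.le
  have h2 := hν.cumGain_le_integral_min hh_pos hh_sum (Nat.succ_le_of_lt k.2)
  -- Concavity puts the integral above its chord between consecutive prefixes. By `h1` and `h2` that
  -- chord lies above the line of slope `α k` that bounds the sum over `A` in `hA`.
  obtain ⟨a, b, ha, hb, hab, hcomb⟩ : t ∈ segment ℝ (cumGain h k.val) (cumGain h (k.val + 1)) := by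
    rw [segment_eq_Icc (hk1.trans hk2)]; exact ⟨hk1, hk2⟩
  have hc := hν.concaveOn.2 (Set.mem_univ (cumGain h k.val))
    (Set.mem_univ (cumGain h (k.val + 1))) ha hb hab
  simp only [hcomb] at hc
  refine le_trans ?_ hc
  have h3 := add_le_add (mul_le_mul_of_nonneg_left h1 ha) (mul_le_mul_of_nonneg_left h2 hb)
  refine le_trans ?_ h3
  rw [smul_eq_mul, smul_eq_mul] at hcomb
  rw [Nat.succ_eq_add_one, cumGain_succ]
  rw [cumGain_succ] at hcomb
  rw [← ht, ← hcomb] at hA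
  obtain rfl : a = 1 - b := by linarith
  linarith

/-! ### Realizing a stop-loss feasible law by an input vector -/

theorem IsStopLossFeasible.integral_greedyFill (hν : IsStopLossFeasible h α ν)
    (hh_pos : ∀ i, 0 < h i) (e : Equiv.Perm (Fin n)) (i : Fin n) :
    h i * ∫ s, greedyFill h e s i ∂ν = ∫ s, min s (prefixSum e h ((e.symm i).val + 1)) ∂ν -
      ∫ s, min s (prefixSum e h (e.symm i).val) ∂ν := by
  rw [← integral_const_mul, ← integral_sub (hν.integrable_min _) (hν.integrable_min _)]
  simp_rw [mul_greedyFill hh_pos]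

theorem IsStopLossFeasible.mem_convexHull (hν : IsStopLossFeasible h α ν)
    (hh_pos : ∀ i, 0 < h i) (hh_sum : ∑ i, h i = 1) (hα_anti : Antitone α) :
    α ∈ convexHull ℝ (Set.range fun (e : Equiv.Perm (Fin n)) i => ∫ s, greedyFill h e s i ∂ν) := by
  by_contra hα
  obtain ⟨f, u, hfu, hu⟩ := geometric_hahn_banach_closed_point (convex_convexHull ℝ _)
    ((Set.finite_range _).isClosed_convexHull ℝ) hα
  let w : Fin n → ℝ := fun i => f fun j => if i = j then 1 else 0
  have hf (x : Fin n → ℝ) : f x = ∑ i, x i * w i :=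
    LinearMap.pi_apply_eq_sum_univ (f : (Fin n → ℝ) →ₗ[ℝ] ℝ) x
  let c : Fin n → ℝ := fun i => w i / h i
  -- Filling by decreasing gain `w i / h i` per unit of mass is the order that favours `f`.
  let e := Tuple.sort (-c)
  have hc : Antitone (c ∘ e) := fun a b hab => neg_le_neg_iff.1 (Tuple.monotone_sort (-c) hab)
  have hlt := (hfu _ (subset_convexHull ℝ _ ⟨e, rfl⟩)).trans hu
  rw [hf, hf] at hlt
  -- `F` is the slack of the set constraints along the prefixes of `e`; it vanishes at both ends.
  let F : ℕ → ℝ := fun j => ∫ s, min s (prefixSum e h j) ∂ν - prefixSum e (fun i => h i * α i) j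
  have key := sum_antitone_mul_nonneg e hc (F := F)
    (fun j => sub_nonneg.2 (hν.sum_le_integral_min hh_pos hh_sum hα_anti _))
    (by simp only [F, prefixSum_zero, hν.integral_min_zero, sub_self])
    (by simp only [F, prefixSum_length, hh_sum, hν.integral_min_one, sub_self])
  refine key.not_gt ?_
  rw [← sub_neg, ← Finset.sum_sub_distrib] at hlt
  refine (Finset.sum_congr rfl fun i _ => ?_).trans_lt hlt
  have hF : F ((e.symm i).val + 1) - F (e.symm i).val =
      h i * (∫ s, greedyFill h e s i ∂ν - α i) := by
    rw [mul_sub, hν.integral_greedyFill hh_pos]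
    simp only [F, prefixSum_succ e (fun i => h i * α i)]
    ring
  rw [hF, ← mul_assoc, div_mul_cancel₀ _ (hh_pos i).ne']
  ring

theorem measurable_weightedSum (h : Fin n → ℝ) : Measurable (weightedSum h) := by
  unfold weightedSum
  fun_prop

theorem IsStopLossFeasible.exists_isFeasibleInput (hν : IsStopLossFeasible h α ν)
    (hh_pos : ∀ i, 0 < h i) (hh_sum : ∑ i, h i = 1) (hα_anti : Antitone α) :
    ∃ μ, IsFeasibleInput α μ ∧ μ.map (weightedSum h) = ν := by
  have := hν.isProbabilityMeasure
  obtain ⟨ι, _, w, z, hw0, hw1, hz, hα⟩ :=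
    mem_convexHull_iff_exists_fintype.1 (hν.mem_convexHull hh_pos hh_sum hα_anti)
  choose e he using hz
  -- Averaging the fills pointwise makes the input a deterministic function of `S`; the cube and the
  -- identity `hᵀx = s` survive convex combination.
  let φ : ℝ → Fin n → ℝ := fun s i => ∑ j, w j * greedyFill h (e j) s i
  have hφ : Measurable φ := by
    have (j : ι) := (continuous_greedyFill h (e j)).measurable
    unfold φ
    fun_prop
  have hmem (s : ℝ) (i : Fin n) : φ s i ∈ Set.Icc (0 : ℝ) 1 := by
    have hg (j : ι) := greedyFill_mem_Icc hh_pos (e j) s i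
    exact (convex_Icc (0 : ℝ) 1).sum_mem (fun j _ => hw0 j) hw1 fun j _ => hg j
  refine ⟨ν.map φ, ⟨Measure.isProbabilityMeasure_map hφ.aemeasurable, ?_, fun k => ?_⟩, ?_⟩
  · rw [ae_map_iff hφ.aemeasurable (by measurability)]
    exact ae_of_all _ hmem
  · rw [integral_map hφ.aemeasurable (measurable_pi_apply k).aestronglyMeasurable, ← hα]
    simp only [φ, Finset.sum_apply, Pi.smul_apply, smul_eq_mul, ← he]
    rw [integral_finsetSum]
    · simp_rw [integral_const_mul]
    · exact fun j _ => (Integrable.of_mem_Icc 0 1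
        ((continuous_apply k).comp (continuous_greedyFill h (e j))).aemeasurable
        (ae_of_all _ fun s => greedyFill_mem_Icc hh_pos (e j) s k)).const_mul _
  · rw [Measure.map_map (measurable_weightedSum h) hφ]
    refine (Measure.map_congr (hν.mem_Icc.mono fun s hs => ?_)).trans Measure.map_id
    have hfill (j : ι) := weightedSum_greedyFill hh_pos (e j) hh_sum hs
    unfold weightedSum at hfill
    simp only [Function.comp_apply, weightedSum, φ, Finset.mul_sum, id_eq]
    rw [Finset.sum_comm]
    simp_rw [mul_left_comm (h _), ← Finset.mul_sum, hfill, ← Finset.sum_mul, hw1, one_mul]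

/-! ### Necessity of the stop-loss constraints -/

theorem IsFeasibleInput.isStopLossFeasible {μ : Measure (Fin n → ℝ)} (hμ : IsFeasibleInput α μ)
    (hh_pos : ∀ i, 0 < h i) (hh_sum : ∑ i, h i = 1) :
    IsStopLossFeasible h α (μ.map (weightedSum h)) := by
  have := hμ.isProbabilityMeasure
  have hm := measurable_weightedSum h
  have hint (i : Fin n) : Integrable (fun x : Fin n → ℝ => h i * x i) μ :=
    (Integrable.of_mem_Icc 0 1 (measurable_pi_apply i).aemeasurable (hμ.mem_Icc.mono fun x hx => hx i)).const_mul _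
  have hintS : Integrable (weightedSum h) μ := integrable_finsetSum _ fun i _ => hint i
  refine ⟨Measure.isProbabilityMeasure_map hm.aemeasurable, ?_, ?_, fun k hk1 hkn => ?_⟩
  · refine (ae_map_iff hm.aemeasurable measurableSet_Icc).2 ?_
    filter_upwards [hμ.mem_Icc] with x hx
    refine ⟨Finset.sum_nonneg fun i _ => mul_nonneg (hh_pos i).le (hx i).1, ?_⟩
    exact (Finset.sum_le_sum fun i _ => mul_le_of_le_one_right (hh_pos i).le (hx i).2).trans_eq
      hh_sum
  · rw [integral_map hm.aemeasurable (by fun_prop)]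
    unfold weightedSum
    rw [integral_finsetSum _ fun i _ => hint i]
    simp_rw [integral_const_mul, hμ.mean_eq]
  · rw [integral_map hm.aemeasurable (by fun_prop),
      one_sub_cumGain_mul_tailAvg α hh_pos hh_sum (by omega)]
    have htail : ∫ x, ∑ i with k ≤ (i : Fin n).val, h i * x i ∂μ =
        ∑ i with k ≤ (i : Fin n).val, h i * α i := by
      rw [integral_finsetSum _ fun i _ => hint i]
      simp_rw [integral_const_mul, hμ.mean_eq]
    rw [← htail]
    refine integral_mono_ae (hintS.sub (integrable_const _)).pos_part
      (integrable_finsetSum _ fun i _ => hint i) ?_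
    filter_upwards [hμ.mem_Icc] with x hx
    -- The first `k` coordinates contribute at most `H_[k]`, so the excess is covered by the tail,
    -- which is nonnegative.
    refine max_le ?_ (Finset.sum_nonneg fun i _ => mul_nonneg (hh_pos i).le (hx i).1)
    rw [weightedSum, ← cumGain_add_tail (fun i => h i * x i) k, sub_le_iff_le_add, add_comm]
    refine add_le_add_right (Finset.sum_le_sum fun i _ => ?_) _
    exact mul_le_of_le_one_right (hh_pos i).le (hx i).2

end StopLoss

end OIC


theorem corollary2 {n : ℕ} (h α : Fin n → ℝ) (σ : ℝ)
    (hh_pos : ∀ i, 0 < h i) (hh_sum : ∑ i, h i = 1)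
    (hα_mem : ∀ i, α i ∈ Set.Icc (0 : ℝ) 1) (hα_anti : Antitone α)
    (hσ : 0 < σ) :
    OIC.capacityEC h α σ =
      ⨆ (ν : Measure ℝ) (_ : OIC.IsStopLossFeasible h α ν),
        OIC.mutualInfo (fun ω : ℝ × ℝ => ω.1) (fun ω => ω.1 + ω.2)
          (ν.prod (OIC.noise σ)) := by
  refine le_antisymm (iSup₂_le fun μ hμ => ?_) (iSup₂_le fun ν hν => ?_)
  · have := hμ.isProbabilityMeasure
    rw [OIC.mutualInfo_add_noise μ (OIC.measurable_weightedSum h) hσ]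
    exact le_iSup₂_of_le _ (hμ.isStopLossFeasible hh_pos hh_sum) le_rfl
  · obtain ⟨μ, hμ, rfl⟩ := hν.exists_isFeasibleInput hh_pos hh_sum hα_anti
    have := hμ.isProbabilityMeasure
    rw [← OIC.mutualInfo_add_noise μ (OIC.measurable_weightedSum h) hσ]
    exact le_iSup₂_of_le (f := fun μ (_ : OIC.IsFeasibleInput α μ) => OIC.mutualInfo
      (fun ω : (Fin n → ℝ) × ℝ => ω.1) (fun ω => OIC.weightedSum h ω.1 + ω.2)
      (μ.prod (OIC.noise σ))) μ hμ le_rfl
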